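/- Let $\mathbb F_q$ be a finite field. A curve over $\mathbb F_q$ is a nonsingular projective geometrically integral scheme of dimension $1$ over $\mathbb F_q$, and $\mathbb F_q(X)$ is the function field of a curve $X$. A finite morphism $f\colon X\to Y$ of curves over $\mathbb F_q$ is called separable if the field extension $\mathbb F_q(X)/\mathbb F_q(Y)$ is separable, and is called an exceptional cover if the diagonal is the only geometrically irreducible component defined over $\mathbb F_q$ of the fiber product $X\times_Y X$. A local field is a field which is complete with respect to a discrete valuation and has finite residue field. A finite separable extension $L/K$ of local fields, with Galois closure $N$, is called exceptional if (1) $L$ is totally ramified over $K$, and (2) for every $\sigma\in \mathrm{Gal}(N/K)\setminus \mathrm{Gal}(N/L)$ the compositum $L.\sigma(L)$ of $L$ and $\sigma(L)$ is not totally ramified over $K$. Theorem 3.3. Let $f\colon X\to Y$ be a finite separable morphism of curves over $\mathbb F_q$, and suppose that $f$ is an exceptional cover. Then for every $\mathbb F_q$-rational point $u\in X(\mathbb F_q)$, with $v:=f(u)$, the extension $\mathbb F_q(X)_u/\mathbb F_q(Y)_v$ is an exceptional extension of local fields, where $\mathbb F_q(X)_u$ and $\mathbb F_q(Y)_v$ are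 the completions of $\mathbb F_q(X)$ and $\mathbb F_q(Y)$ at the places $u$ and $v$, respectively. -/

import Mathlib

open CategoryTheory CategoryTheory.Limits AlgebraicGeometry TopologicalSpace
open IsDedekindDomain IsDedekindDomain.HeightOneSpectrum
open scoped Valued WithZero

universe u

noncomputable section

/-! ### Exceptional extensions of local fields -/

section LocalFields

variable {Γ₀ Γ₁ : Type*} [LinearOrderedCommGroupWithZero Γ₀] [LinearOrderedCommGroupWithZero Γ₁]

/-- A local field: a field that is complete with respect to a discrete valuation and has finite
residue field. -/
structure IsLocalField (K : Type u) [Field K] [Valued K Γ₀] : Prop where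
  complete : CompleteSpace K
  discrete : IsDiscreteValuationRing 𝒪[K]
  finite_residueField : Finite 𝓀[K]

/-- A finite extension `E` of a local field `K` is totally ramified if there is exactly one prime
of the valuation ring of `E` (the integral closure of the valuation ring of `K` in `E`) above the
maximal ideal of the valuation ring of `K`, and the residue field extension has degree `1`. -/
def IsTotallyRamified (K E : Type u) [Field K] [Valued K Γ₀] [Field E] [Algebra K E] : Prop :=
  ∃ P : Ideal (integralClosure 𝒪[K] E),
    Ideal.primesOver 𝓂[K] (integralClosure 𝒪[K] E) = {P} ∧ P.inertiaDeg 𝒪[K] = 1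

/-- The Galois closure of a finite separable extension `L / K`, as a field extension of `L` (and
hence of `K`). -/
abbrev galoisClosure (K L : Type u) [Field K] [Field L] [Algebra K L] :
    IntermediateField K (AlgebraicClosure L) :=
  IntermediateField.normalClosure K L (AlgebraicClosure L)

/-- The field `L`, regarded as an intermediate field of the Galois closure of `L / K`. -/
def baseInGaloisClosure (K L : Type u) [Field K] [Field L] [Algebra K L] :
    IntermediateField K (galoisClosure K L) :=
  (IsScalarTower.toAlgHom K L (galoisClosure K L)).fieldRange

/-- `L / K` is an exceptional extension of local fields: it is a finite separable extension of
local fields (the valuation of `L` extending that of `K`), totally ramified, and for every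
`σ ∈ Gal(N/K) ∖ Gal(N/L)`, where `N` is the Galois closure of `L / K`, the compositum `L.σ(L)`
is not totally ramified over `K`. -/
structure IsExceptionalLocalExtension (K L : Type u) [Field K] [Field L] [Valued K Γ₀]
    [Valued L Γ₁] [Algebra K L] : Prop where
  isLocalField_base : IsLocalField K
  isLocalField_top : IsLocalField L
  valuation_compat : ∀ x : K, Valued.v (algebraMap K L x) ≤ 1 ↔ Valued.v x ≤ 1
  finite : FiniteDimensional K L
  separable : Algebra.IsSeparable K L
  totallyRamified : IsTotallyRamified K L
  not_totallyRamified_compositum : ∀ σ : galoisClosure K L ≃ₐ[K] galoisClosure K L,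
    σ ∉ (baseInGaloisClosure K L).fixingSubgroup →
      ¬ IsTotallyRamified K
        ↥(baseInGaloisClosure K L ⊔ (baseInGaloisClosure K L).map σ.toAlgHom)

/-- A field embedding `φ : K → L` makes `L / K` an exceptional extension of local fields. -/
def IsExceptionalLocalEmbedding {K L : Type u} [Field K] [Field L] [Valued K Γ₀]
    [Valued L Γ₁] (φ : K →+* L) : Prop :=
  letI := φ.toAlgebra
  IsExceptionalLocalExtension K L

end LocalFields

/-- The map `K_v → L_w` of completions induced by an extension `L / K` of fraction fields of
Dedekind domains, for a prime `w` over `v`: the unique continuous extension of `K → L`. -/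
def adicCompletionMap {A B K L : Type u} [CommRing A] [IsDedekindDomain A] [CommRing B]
    [IsDedekindDomain B] [Algebra A B] [Module.IsTorsionFree A B] [Field K] [Field L]
    [Algebra K L] [Algebra A K] [IsFractionRing A K] [Algebra A L] [IsScalarTower A K L]
    [Algebra B L] [IsFractionRing B L] [IsScalarTower A B L] (v : HeightOneSpectrum A)
    (w : HeightOneSpectrum B) [w.asIdeal.LiesOver v.asIdeal] :
    v.adicCompletion K →+* w.adicCompletion L :=
  (adicCompletion.equiv L w).symm.toRingHom.comp
    ((UniformSpace.Completion.mapRingHom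
      (algebraMap (WithVal (v.valuation K)) (WithVal (w.valuation L)))
      (uniformContinuous_algebraMap_liesOver K L v w).continuous).comp
    (adicCompletion.equiv K v).toRingHom)

/-! ### Curves -/

attribute [local instance] MvPolynomial.gradedAlgebra

/-- Projective `n`-space over `k`, as the `Proj` of the polynomial ring in `n + 1` variables. -/
def projSpace (k : Type u) [Field k] (n : ℕ) : Scheme.{u} :=
  Proj (MvPolynomial.homogeneousSubmodule (Fin (n + 1)) k)

/-- The structure morphism of projective `n`-space over `k`. -/
def projSpaceStr (k : Type u) [Field k] (n : ℕ) : projSpace k n ⟶ Spec (.of k) :=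
  Proj.toSpecZero (MvPolynomial.homogeneousSubmodule (Fin (n + 1)) k) ≫
    Spec.map (CommRingCat.ofHom
      (algebraMap k (MvPolynomial.homogeneousSubmodule (Fin (n + 1)) k 0)))

/-- A (nonsingular projective) curve over `k`: a geometrically integral separated scheme of finite
type over `k`, of dimension `1`, all of whose local rings are regular, and which admits a closed
immersion over `k` into some projective space. -/
structure Curve (k : Type u) [Field k] where
  /-- The underlying scheme. -/
  toScheme : Scheme.{u}
  /-- The structure morphism. -/
  str : toScheme ⟶ Spec (.of k)
  geometricallyIntegral : GeometricallyIntegral str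
  separated : IsSeparated str
  locallyOfFiniteType : LocallyOfFiniteType str
  quasiCompact : QuasiCompact str
  dim_eq_one : topologicalKrullDim toScheme = 1
  regular : ∀ x : toScheme, IsRegularLocalRing (toScheme.presheaf.stalk x)
  projective : ∃ (n : ℕ) (i : toScheme ⟶ projSpace k n),
    IsClosedImmersion i ∧ i ≫ projSpaceStr k n = str

namespace Curve

variable {k : Type u} [Field k]

instance (X : Curve k) : IsIntegral X.toScheme :=
  have := X.geometricallyIntegral
  GeometricallyIntegral.isIntegral_of_subsingleton X.str

instance (X : Curve k) : IsSeparated X.str := X.separated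

/-- A place of the function field of `X`, i.e. a closed point of the curve `X`. -/
abbrev Place (X : Curve k) : Type u := {x : X.toScheme // IsClosed ({x} : Set X.toScheme)}

theorem not_subsingleton (X : Curve k) : ¬ Subsingleton X.toScheme := by
  intro h
  have h0 := topologicalKrullDim_zero_of_discreteTopology X.toScheme
  rw [X.dim_eq_one] at h0
  exact absurd h0 (by decide)

theorem ne_genericPoint (X : Curve k) (x : X.Place) : x.1 ≠ genericPoint X.toScheme := by
  intro h
  apply X.not_subsingleton
  have h1 := genericPoint_closure (α := X.toScheme)
  rw [← h, x.2.closure_eq] at h1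
  exact Set.subsingleton_univ_iff.mp (h1 ▸ Set.subsingleton_singleton)

theorem krullDim_eq_one (X : Curve k) : Order.krullDim X.toScheme = 1 := by
  rw [← X.dim_eq_one]
  let := specializationOrder X.toScheme
  exact (Order.krullDim_eq_of_orderIso (irreducibleSetEquivPoints (α := X.toScheme))).symm

theorem lt_genericPoint (X : Curve k) {x : X.toScheme} (hx : x ≠ genericPoint X.toScheme) :
    x < genericPoint X.toScheme := by
  have h : genericPoint X.toScheme ⤳ x := (genericPoint_spec X.toScheme).specializes trivial
  exact ⟨h, fun h' ↦ hx (Specializes.antisymm h' h).eq⟩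

theorem isClosed_of_ne_genericPoint (X : Curve k) {x : X.toScheme}
    (hx : x ≠ genericPoint X.toScheme) : IsClosed ({x} : Set X.toScheme) := by
  refine isClosed_of_closure_subset fun y hy ↦ ?_
  by_contra hne
  have hxy : x ⤳ y := specializes_iff_mem_closure.mpr hy
  have hlt : y < x := ⟨hxy, fun h' ↦ hne (Specializes.antisymm h' hxy).eq⟩
  let s : LTSeries X.toScheme := LTSeries.mk 2 ![y, x, genericPoint X.toScheme]
    (Fin.strictMono_iff_lt_succ.mpr fun i ↦ by
      fin_cases i
      · exact hlt
      · exact X.lt_genericPoint hx)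
  have hs : s.length = 2 := rfl
  have h := Order.LTSeries.length_le_krullDim s
  rw [X.krullDim_eq_one, hs] at h
  exact absurd h (by decide)

theorem isDiscreteValuationRing_stalk (X : Curve k) (x : X.Place) :
    IsDiscreteValuationRing (X.toScheme.presheaf.stalk x.1) := by
  have := X.regular x.1
  have hco : (Order.coheight x.1 : WithBot ℕ∞) = 1 := by
    apply le_antisymm
    · rw [← X.krullDim_eq_one]
      exact Order.coheight_le_krullDim x.1
    · have hlt := X.lt_genericPoint (X.ne_genericPoint x)
      have : Order.coheight x.1 ≠ 0 := by
        rw [Order.coheight_ne_zero]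
        exact hlt.not_isMax
      exact_mod_cast Order.one_le_iff_ne_zero.mpr this
  rw [← IsLocalRing.finrank_CotangentSpace_eq_one_iff]
  have h := (IsRegularLocalRing.iff_finrank_cotangentSpace _).mp (X.regular x.1)
  rw [ringKrullDim_stalk_eq_coheight, hco] at h
  exact_mod_cast h

instance (X : Curve k) (x : X.Place) :
    IsDiscreteValuationRing (X.toScheme.presheaf.stalk x.1) :=
  X.isDiscreteValuationRing_stalk x

/-- The completion of the function field `k(X)` at the place `x`, with its valuation. -/
abbrev completion (X : Curve k) (x : X.Place) : Type u :=
  (IsDiscreteValuationRing.maximalIdeal (X.toScheme.presheaf.stalk x.1)).adicCompletion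
    X.toScheme.functionField

/-- A `k`-rational point of `X`: a section of the structure morphism. -/
structure RationalPoint (X : Curve k) where
  /-- The underlying morphism. -/
  hom : Spec (.of k) ⟶ X.toScheme
  hom_str : hom ≫ X.str = 𝟙 _

/-- The place of `X` given by a `k`-rational point. -/
def RationalPoint.place {X : Curve k} (P : X.RationalPoint) : X.Place :=
  ⟨P.hom (IsLocalRing.closedPoint k), by
    have : IsClosedImmersion (P.hom ≫ X.str) := by rw [P.hom_str]; infer_instance
    have : IsClosedImmersion P.hom := IsClosedImmersion.of_comp P.hom X.str
    have h := P.hom.isClosedEmbedding.isClosedMap _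
      (IsLocalRing.isClosed_singleton_closedPoint k)
    exact (Set.image_singleton (f := P.hom)) ▸ h⟩

variable {X Y : Curve k}

/-- A finite morphism of curves is dominant. -/
theorem isDominant_of_isFinite (f : X.toScheme ⟶ Y.toScheme) [IsFinite f] : IsDominant f := by
  have hgen : ∀ x, genericPoint X.toScheme ⤳ x := fun x ↦
    (genericPoint_spec X.toScheme).specializes trivial
  have heq : f (genericPoint X.toScheme) = genericPoint Y.toScheme := by
    by_contra hne
    have hc := Y.isClosed_of_ne_genericPoint hne
    have huniv : f ⁻¹' {f (genericPoint X.toScheme)} = Set.univ := by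
      refine Set.eq_univ_of_forall fun x ↦ ?_
      exact ((hgen x).map f.continuous).mem_closed hc rfl
    have hd := f.isDiscrete_preimage_singleton (f (genericPoint X.toScheme))
    rw [huniv] at hd
    have := isDiscrete_univ_iff.mp hd
    exact X.not_subsingleton (subsingleton_of_forall_eq _ fun x ↦ (hgen x).eq.symm)
  constructor
  intro y
  have hsub : ({f (genericPoint X.toScheme)} : Set Y.toScheme) ⊆ Set.range f :=
    Set.singleton_subset_iff.mpr ⟨genericPoint X.toScheme, rfl⟩
  refine closure_mono hsub ?_
  rw [heq, genericPoint_closure]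
  trivial

theorem map_genericPoint (f : X.toScheme ⟶ Y.toScheme) [IsFinite f] :
    f (genericPoint X.toScheme) = genericPoint Y.toScheme := by
  have := isDominant_of_isFinite f
  have h := (genericPoint_spec X.toScheme).image f.continuous
  rw [Set.image_univ, f.denseRange.closure_range] at h
  exact h.eq (genericPoint_spec Y.toScheme)

/-- The embedding of function fields `k(Y) → k(X)` induced by a finite morphism `f : X → Y`. -/
def functionFieldMap (f : X.toScheme ⟶ Y.toScheme) [IsFinite f] :
    Y.toScheme.functionField →+* X.toScheme.functionField :=
  (Y.toScheme.presheaf.stalkSpecializes (specializes_of_eq (map_genericPoint f)) ≫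
    f.stalkMap (genericPoint X.toScheme)).hom

/-- The image of a place of `X` under a finite morphism `f : X → Y`. -/
def Place.map (f : X.toScheme ⟶ Y.toScheme) [IsFinite f] (x : X.Place) : Y.Place :=
  ⟨f x.1, by
    have h := f.isClosedMap _ x.2
    exact (Set.image_singleton (f := f)) ▸ h⟩

/-- The homomorphism of local rings `𝒪_{Y, f(x)} → 𝒪_{X, x}`. -/
def localRingMap (f : X.toScheme ⟶ Y.toScheme) [IsFinite f] (x : X.Place) :
    Y.toScheme.presheaf.stalk (x.map f).1 →+* X.toScheme.presheaf.stalk x.1 :=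
  (f.stalkMap x.1).hom

instance (f : X.toScheme ⟶ Y.toScheme) [IsFinite f] (x : X.Place) :
    IsLocalHom (localRingMap f x) :=
  inferInstanceAs (IsLocalHom (f.stalkMap x.1).hom)

theorem functionFieldMap_algebraMap (f : X.toScheme ⟶ Y.toScheme) [IsFinite f] (x : X.Place)
    (a : Y.toScheme.presheaf.stalk (x.map f).1) :
    functionFieldMap f (algebraMap _ _ a) = algebraMap _ _ (localRingMap f x a) := by
  have h := Scheme.Hom.stalkSpecializes_stalkMap_apply f (genericPoint X.toScheme) x.1
    ((genericPoint_spec X.toScheme).specializes trivial) a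
  refine Eq.trans ?_ h
  simp only [functionFieldMap, CommRingCat.hom_comp, RingHom.comp_apply]
  congr 1
  exact ConcreteCategory.congr_hom (Y.toScheme.presheaf.stalkSpecializes_comp _ _) a

theorem localRingMap_injective (f : X.toScheme ⟶ Y.toScheme) [IsFinite f] (x : X.Place) :
    Function.Injective (localRingMap f x) := by
  intro a b hab
  apply IsFractionRing.injective (Y.toScheme.presheaf.stalk (x.map f).1) Y.toScheme.functionField
  apply (functionFieldMap f).injective
  rw [functionFieldMap_algebraMap, functionFieldMap_algebraMap, hab]

/-- The embedding `k(Y)_{f(x)} → k(X)_x` of completed function fields induced by a finite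
morphism `f : X → Y` of curves and a place `x` of `X`: the unique continuous extension of
`k(Y) → k(X)`. -/
def completionMap (f : X.toScheme ⟶ Y.toScheme) [IsFinite f] (x : X.Place) :
    Y.completion (x.map f) →+* X.completion x :=
  letI := (functionFieldMap f).toAlgebra
  letI := (localRingMap f x).toAlgebra
  letI : Algebra (Y.toScheme.presheaf.stalk (x.map f).1) X.toScheme.functionField :=
    ((algebraMap (X.toScheme.presheaf.stalk x.1) X.toScheme.functionField).comp
      (localRingMap f x)).toAlgebra
  haveI : IsScalarTower (Y.toScheme.presheaf.stalk (x.map f).1) (X.toScheme.presheaf.stalk x.1)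
    X.toScheme.functionField := .of_algebraMap_eq fun _ ↦ rfl
  haveI : IsScalarTower (Y.toScheme.presheaf.stalk (x.map f).1) Y.toScheme.functionField
    X.toScheme.functionField := .of_algebraMap_eq fun a ↦ (functionFieldMap_algebraMap f x a).symm
  haveI : Module.IsTorsionFree (Y.toScheme.presheaf.stalk (x.map f).1)
      (X.toScheme.presheaf.stalk x.1) := by
    rw [Module.isTorsionFree_iff_algebraMap_injective]
    exact localRingMap_injective f x
  haveI : (IsDiscreteValuationRing.maximalIdeal (X.toScheme.presheaf.stalk x.1)).asIdeal.LiesOver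
      (IsDiscreteValuationRing.maximalIdeal
        (Y.toScheme.presheaf.stalk (x.map f).1)).asIdeal :=
    ⟨(IsLocalRing.maximalIdeal_comap (localRingMap f x)).symm⟩
  adicCompletionMap
    (IsDiscreteValuationRing.maximalIdeal (Y.toScheme.presheaf.stalk (x.map f).1))
    (IsDiscreteValuationRing.maximalIdeal (X.toScheme.presheaf.stalk x.1))

/-- A finite morphism of curves is separable if the function field extension `k(X) / k(Y)` is. -/
def IsSeparableMorphism (f : X.toScheme ⟶ Y.toScheme) [IsFinite f] : Prop :=
  letI := (functionFieldMap f).toAlgebra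
  Algebra.IsSeparable Y.toScheme.functionField X.toScheme.functionField

/-- A finite morphism `f : X → Y` of curves over `k` is an exceptional cover if the diagonal is the
only geometrically irreducible component defined over `k` of the fiber product `X ×_Y X`.
Irreducible components carry their reduced induced structure. -/
def IsExceptionalCover (f : X.toScheme ⟶ Y.toScheme) : Prop :=
  ∀ Z : Closeds ↥(pullback f f),
    ((Z : Set ↥(pullback f f)) ∈ irreducibleComponents ↥(pullback f f) ∧
      GeometricallyIrreducible ((Scheme.IdealSheafData.vanishingIdeal Z).subschemeι ≫
        pullback.fst f f ≫ X.str)) ↔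
    (Z : Set ↥(pullback f f)) = Set.range (pullback.diagonal f)

end Curve

end

/-!
Write `K = k(Y)_v` and `L = k(X)_u`. That `L / K` is a finite separable totally ramified extension
of local fields follows from the density of `k(X)` in `L` and from the residue fields of `u` and `v`
both being `k`. The point is that `M = L.σ(L)` is never totally ramified when `σ` moves `L`.

Suppose it is. Then the integral closure of the valuation ring of `K` in `M` is a discrete valuation
ring with residue field `k`, and reduction modulo a uniformizer shows that `M ⊗ k'` is a domain for
every field extension `k' / k` (`isDomain_fractionRing_tensorProduct_of_residue_surjective`), so
`Spec M` is geometrically irreducible over `k` (`IsTotallyRamified.geometricallyIrreducible`).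
The inclusion `k(X) → L → M` and its composition with `σ` agree on `k(Y)`, hence define a morphism
`Spec M → X ×_Y X`. The closure of its image is an irreducible component, as the image lies over the
generic point of `X` and the projection to `X` is finite
(`closure_singleton_mem_irreducibleComponents`). It is geometrically irreducible over `k`, since it
is dominated by `Spec M` (`geometricallyIrreducible_of_isDominant`). As `f` is exceptional, this
component is the diagonal, so the two embeddings of `k(X)` are equal
(`Curve.IsExceptionalCover.eq_of_comp_eq`). Thus `σ` fixes `k(X)`, and it fixes `L`, which is spanned
by `k(X)` over `K`.
-/

/-! ### Geometrically irreducible components of the self fibre product -/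

/-- A morphism from a reduced scheme factors through a closed immersion as soon as it does so on
points. -/
theorem exists_lift_of_range_subset {W Z P : Scheme.{u}} [IsReduced W] (i : Z ⟶ P)
    [IsClosedImmersion i] (g : W ⟶ P) (h : Set.range g ⊆ Set.range i) :
    ∃ g' : W ⟶ Z, g' ≫ i = g := by
  have hker : i.ker ≤ g.ker := by
    rw [← Scheme.IdealSheafData.map_bot g, ← Scheme.nilradical_eq_bot,
      ← Scheme.IdealSheafData.vanishingIdeal_top, Scheme.IdealSheafData.map_vanishingIdeal,
      ← Scheme.IdealSheafData.le_support_iff_le_vanishingIdeal, Closeds.closure_le]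
    refine subset_trans ?_ (Scheme.Hom.range_subset_ker_support i)
    simpa using h
  exact ⟨IsClosedImmersion.lift i g hker, IsClosedImmersion.lift_fac i g hker⟩

/-- Over a field, geometric irreducibility passes to the target of a dominant morphism: base change
along a field extension is open, hence preserves dominance. -/
theorem geometricallyIrreducible_of_isDominant {k : Type u} [Field k] {W Z : Scheme.{u}}
    (g : W ⟶ Z) [IsDominant g] (s : Z ⟶ Spec (.of k)) [GeometricallyIrreducible (g ≫ s)] :
    GeometricallyIrreducible s := by
  refine ⟨geometrically_iff_of_isClosedUnderIsomorphisms.mpr fun K _ y ↦ ?_⟩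
  have : IrreducibleSpace ↥(pullback (g ≫ s) y) :=
    GeometricallyIrreducible.geometrically_irreducibleSpace _ _ _
      (IsPullback.of_hasPullback (g ≫ s) y)
  have : IrreducibleSpace ↥(pullback g (pullback.fst s y)) :=
    (pullbackRightPullbackFstIso s y g).hom.homeomorph.irreducibleSpace_iff.mpr this
  have hopen : IsOpenMap (pullback.fst s y) := (pullback.fst s y).isOpenMap
  have hrange : closure (Set.range (pullback.snd g (pullback.fst s y))) = Set.univ := by
    rw [Scheme.Pullback.range_snd, ← hopen.preimage_closure_eq_closure_preimage
      (pullback.fst s y).continuous, g.denseRange.closure_range, Set.preimage_univ]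
  rw [irreducibleSpace_def, Set.top_eq_univ, ← hrange, ← Set.image_univ]
  exact ((IrreducibleSpace.isIrreducible_univ _).image _
    (pullback.snd g (pullback.fst s y)).continuous.continuousOn).closure

/-- A point of the source of a base change of a finite morphism that lies over a generic point is
itself a generic point of an irreducible component, because fibres are discrete. -/
theorem closure_singleton_mem_irreducibleComponents {P X : Scheme.{u}} (p : P ⟶ X) [IsFinite p]
    [IrreducibleSpace X] {z : P} (hz : p z = genericPoint X) :
    closure {z} ∈ irreducibleComponents P := by
  refine ⟨isIrreducible_singleton.closure, fun T hT hle ↦ ?_⟩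
  obtain ⟨w, hw⟩ := QuasiSober.sober hT.closure isClosed_closure
  have hwz : w ⤳ z := hw.specializes (subset_closure (hle (subset_closure rfl)))
  have hpw : p w = genericPoint X := by
    refine ((genericPoint_spec X).specializes trivial).antisymm ?_ |>.eq.symm
    exact hz ▸ hwz.map p.continuous
  have hdisc := p.isDiscrete_preimage_singleton (genericPoint X)
  have hmem : (⟨w, hpw⟩ : p ⁻¹' {genericPoint X}) ⤳ ⟨z, hz⟩ :=
    Topology.IsInducing.subtypeVal.specializes_iff.mp hwz
  have : DiscreteTopology (p ⁻¹' {genericPoint X}) := hdisc.to_subtype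
  have heq : w = z := congrArg Subtype.val hmem.eq
  rw [← heq, hw.def]
  exact subset_closure

namespace Curve

variable {k : Type u} [Field k] {X Y : Curve k}

/-- For an exceptional cover `f : X → Y`, two points of `X` in a field `M`, both generic, that agree
in `Y` are equal, provided that `Spec M` is geometrically irreducible over `k`: otherwise the closure
of the image of `Spec M → X ×_Y X` would be a geometrically irreducible component different from the
diagonal. -/
theorem IsExceptionalCover.eq_of_comp_eq {f : X.toScheme ⟶ Y.toScheme} [IsFinite f]
    (hexc : IsExceptionalCover f) {M : Type u} [Field M] (a b : Spec (.of M) ⟶ X.toScheme)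
    (hab : a ≫ f = b ≫ f)
    (x : ↥(Spec (CommRingCat.of M))) (ha : a x = genericPoint X.toScheme)
    [GeometricallyIrreducible (a ≫ X.str)] : a = b := by
  set g : Spec (.of M) ⟶ pullback f f := pullback.lift a b hab with hg
  set z : ↥(pullback f f) := g x with hzdef
  have hgz : Set.range g = {z} := by
    have : Subsingleton ↥(Spec (CommRingCat.of M)) :=
      inferInstanceAs (Subsingleton (PrimeSpectrum M))
    exact Set.eq_singleton_iff_unique_mem.mpr ⟨⟨_, rfl⟩, by
      rintro _ ⟨t, rfl⟩; rw [hzdef, Subsingleton.elim t x]⟩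
  have hz : pullback.fst f f z = genericPoint X.toScheme := by
    rw [← ha, hzdef, ← Scheme.Hom.comp_apply, hg, pullback.lift_fst]
  let Z : Closeds ↥(pullback f f) := Closeds.closure {z}
  have hcomp : (Z : Set ↥(pullback f f)) ∈ irreducibleComponents ↥(pullback f f) :=
    closure_singleton_mem_irreducibleComponents (pullback.fst f f) hz
  set i := (Scheme.IdealSheafData.vanishingIdeal Z).subschemeι with hi
  have hirange : Set.range i = closure {z} := by
    rw [hi, Scheme.IdealSheafData.range_subschemeι, Scheme.IdealSheafData.coe_support_vanishingIdeal]
    rfl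
  obtain ⟨g', hg'⟩ := exists_lift_of_range_subset i g (by
    rw [hgz, hirange]; exact subset_closure)
  have hdom : IsDominant g' := by
    refine ⟨fun t ↦ ?_⟩
    rw [i.isClosedEmbedding.isInducing.closure_eq_preimage_closure_image, Set.mem_preimage,
      ← Set.range_comp]
    have : (i ∘ g' : _ → _) = g := by rw [← hg']; rfl
    rw [this, hgz, ← hirange]
    exact ⟨t, rfl⟩
  have hgeom : GeometricallyIrreducible (g' ≫ i ≫ pullback.fst f f ≫ X.str) := by
    rw [← Category.assoc, hg', ← Category.assoc, hg, pullback.lift_fst]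
    infer_instance
  have hgeomZ : GeometricallyIrreducible (i ≫ pullback.fst f f ≫ X.str) :=
    geometricallyIrreducible_of_isDominant g' _
  have hdiag := (hexc Z).mp ⟨hcomp, hgeomZ⟩
  obtain ⟨d, hd⟩ := exists_lift_of_range_subset (pullback.diagonal f) g (by
    rw [hgz, ← hdiag]; exact subset_closure)
  calc a = g ≫ pullback.fst f f := by rw [hg, pullback.lift_fst]
    _ = g ≫ pullback.snd f f := by rw [← hd]; simp
    _ = b := by rw [hg, pullback.lift_snd]

end Curve

/-! ### Extending scalars in a discrete valuation ring with a rational residue field -/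

section Tensor

open TensorProduct

variable {k R : Type*} [Field k] [CommRing R] [IsDomain R] [IsDiscreteValuationRing R] [Algebra k R]
  (k' : Type*) [Field k'] [Algebra k k']

/-- If `k` is the residue field of the discrete valuation ring `R`, then `R ⊗[k] k'` is a domain:
it is separated for the `t`-adic topology, `t` being a uniformizer of `R`, on which `t` is a
nonzerodivisor, and it becomes the field `k'` modulo `t`. -/
theorem isDomain_tensorProduct_of_residue_surjective
    (hres : ∀ r : R, ∃ c : k, r - algebraMap k R c ∈ IsLocalRing.maximalIdeal R) :
    IsDomain (R ⊗[k] k') := by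
  obtain ⟨t, ht⟩ := IsDiscreteValuationRing.exists_irreducible R
  have hmem (r : R) : r ∈ IsLocalRing.maximalIdeal R ↔ t ∣ r := by
    rw [ht.maximalIdeal_eq, Ideal.mem_span_singleton]
  set B := Module.Free.chooseBasis R (R ⊗[k] k')
  -- expansion to first order in `t`
  have hexp (x : R ⊗[k] k') : ∃ (c : k') (y : R ⊗[k] k'), x = 1 ⊗ₜ c + t • y := by
    induction x with
    | zero => exact ⟨0, 0, by simp⟩
    | tmul r c =>
      obtain ⟨a, ha⟩ := hres r
      obtain ⟨r', hr'⟩ := (hmem _).mp ha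
      refine ⟨a • c, r' ⊗ₜ c, ?_⟩
      rw [TensorProduct.smul_tmul', smul_eq_mul, ← hr', TensorProduct.tmul_smul,
        TensorProduct.smul_tmul', ← TensorProduct.add_tmul, Algebra.smul_def, mul_one,
        add_sub_cancel]
    | add x y hx hy =>
      obtain ⟨c, x', rfl⟩ := hx
      obtain ⟨d, y', rfl⟩ := hy
      exact ⟨c + d, x' + y', by rw [TensorProduct.tmul_add, smul_add]; abel⟩
  -- `t` stays a nonunit by faithful flatness
  have hone : ∀ y : R ⊗[k] k', t • y ≠ 1 := by
    intro y hy
    have h1 : IsUnit (algebraMap R (R ⊗[k] k') t) :=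
      IsUnit.of_mul_eq_one y (by rw [← Algebra.smul_def, hy])
    have h2 := Ideal.comap_map_eq_self_of_faithfullyFlat (B := R ⊗[k] k') (Ideal.span {t})
    rw [Ideal.map_span, Set.image_singleton, Ideal.span_singleton_eq_top.mpr h1, Ideal.comap_top,
      eq_comm, Ideal.span_singleton_eq_top] at h2
    exact ht.not_isUnit h2
  have hunit (c : k') (y : R ⊗[k] k') (h : (1 : R) ⊗ₜ[k] c = t • y) : c = 0 := by
    by_contra hc
    apply hone (((1 : R) ⊗ₜ[k] c⁻¹) * y)
    rw [mul_comm, ← smul_mul_assoc, ← h, Algebra.TensorProduct.tmul_mul_tmul, one_mul,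
      mul_inv_cancel₀ hc, Algebra.TensorProduct.one_def]
  -- coordinates in a basis are divisible by only finitely many powers of `t`
  have hfac (x : R ⊗[k] k') (hx : x ≠ 0) :
      ∃ (n : ℕ) (c : k') (y : R ⊗[k] k'), c ≠ 0 ∧ x = t ^ n • (1 ⊗ₜ c + t • y) := by
    by_contra! hne
    have hdiv : ∀ n : ℕ, ∃ y : R ⊗[k] k', x = t ^ n • y := by
      intro n
      induction n with
      | zero => exact ⟨x, by simp⟩
      | succ n ih =>
        obtain ⟨y, hy⟩ := ih
        obtain ⟨c, z, hz⟩ := hexp y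
        by_cases hc : c = 0
        · exact ⟨z, by rw [hy, hz, hc, tmul_zero, zero_add, smul_smul, pow_succ]⟩
        · exact (hne n c z hc (by rw [hy, hz])).elim
    apply hx
    apply B.repr.injective
    ext i
    rw [map_zero, Finsupp.zero_apply]
    by_contra hi
    obtain ⟨m, hm⟩ := (FiniteMultiplicity.of_not_isUnit ht.not_isUnit hi)
    obtain ⟨y, hy⟩ := hdiv (m + 1)
    exact hm ⟨B.repr y i, by rw [hy, map_smul, Finsupp.smul_apply, smul_eq_mul]⟩
  have : Nontrivial (R ⊗[k] k') := inferInstance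
  have : NoZeroDivisors (R ⊗[k] k') := by
    refine ⟨fun {x y} hxy ↦ ?_⟩
    by_contra! h
    obtain ⟨n, c, x', hc, rfl⟩ := hfac x h.1
    obtain ⟨m, d, y', hd, rfl⟩ := hfac y h.2
    rw [smul_mul_smul_comm, ← pow_add, smul_eq_zero_iff_right (pow_ne_zero _ ht.ne_zero)] at hxy
    refine mul_ne_zero hc hd (hunit _ (-((1 ⊗ₜ c) * y' + x' * (1 ⊗ₜ d) + t • (x' * y'))) ?_)
    rw [← sub_eq_zero, ← hxy, ← mul_one (1 : R), ← Algebra.TensorProduct.tmul_mul_tmul]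
    simp only [Algebra.smul_def, mul_one]
    ring
  exact NoZeroDivisors.to_isDomain _

/-- The fraction field of a discrete valuation ring with residue field `k` stays a domain after
every extension of the field `k`. -/
theorem isDomain_fractionRing_tensorProduct_of_residue_surjective
    (hres : ∀ r : R, ∃ c : k, r - algebraMap k R c ∈ IsLocalRing.maximalIdeal R)
    (M : Type*) [Field M] [Algebra R M] [IsFractionRing R M] [Algebra k M] [IsScalarTower k R M] :
    IsDomain (M ⊗[k] k') := by
  have := isDomain_tensorProduct_of_residue_surjective k' hres
  let j : R ⊗[k] k' →ₐ[R] M ⊗[k] k' :=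
    Algebra.TensorProduct.map (Algebra.ofId R M) (AlgHom.id k k')
  have hj : Function.Injective j :=
    Module.Flat.rTensor_preserves_injective_linearMap (M := k')
      (IsScalarTower.toAlgHom k R M).toLinearMap (IsFractionRing.injective R M)
  have hden (x : M ⊗[k] k') : ∃ (r : R) (y : R ⊗[k] k'), r ≠ 0 ∧ r • x = j y := by
    induction x with
    | zero => exact ⟨1, 0, one_ne_zero, by simp⟩
    | tmul m c =>
      obtain ⟨a, b, hb, rfl⟩ := IsFractionRing.div_surjective (A := R) m
      have hb0 : b ≠ 0 := nonZeroDivisors.ne_zero hb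
      have hb1 : algebraMap R M b ≠ 0 := by simpa using hb0
      refine ⟨b, a ⊗ₜ c, hb0, ?_⟩
      rw [TensorProduct.smul_tmul', Algebra.smul_def, mul_div_cancel₀ _ hb1]
      rfl
    | add x y hx hy =>
      obtain ⟨r, x', hr, hx⟩ := hx
      obtain ⟨s, y', hs, hy⟩ := hy
      refine ⟨r * s, s • x' + r • y', mul_ne_zero hr hs, ?_⟩
      rw [smul_add, map_add, map_smul, map_smul, ← hx, ← hy, smul_smul, smul_smul, mul_comm s]
  have hzero (r : R) (x : M ⊗[k] k') (hr : r ≠ 0) (h : r • x = 0) : x = 0 := by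
    rw [← algebraMap_smul M r x] at h
    exact (smul_eq_zero.mp h).resolve_left (by simpa using hr)
  have : NoZeroDivisors (M ⊗[k] k') := by
    refine ⟨fun {x y} hxy ↦ ?_⟩
    obtain ⟨r, x', hr, hx⟩ := hden x
    obtain ⟨s, y', hs, hy⟩ := hden y
    have h0 : x' * y' = 0 := hj <| by
      rw [map_mul, ← hx, ← hy, smul_mul_smul_comm, hxy, smul_zero, map_zero]
    rcases mul_eq_zero.mp h0 with h | h
    · exact .inl (hzero r x hr (by rw [hx, h, map_zero]))
    · exact .inr (hzero s y hs (by rw [hy, h, map_zero]))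
  exact NoZeroDivisors.to_isDomain _

end Tensor

/-! ### Totally ramified extensions in terms of the residue field -/

/-- The inertia degree of maximal ideals is `1` exactly when every element upstairs is congruent to
an element downstairs. -/
theorem inertiaDeg_eq_one_iff {R S : Type*} [CommRing R] [CommRing S] [Algebra R S] (p : Ideal R)
    (q : Ideal S) [p.IsMaximal] [q.IsMaximal] [q.LiesOver p] :
    q.inertiaDeg R = 1 ↔ ∀ s : S, ∃ r : R, s - algebraMap R S r ∈ q := by
  rw [Ideal.inertiaDeg_eq_of_isMaximal p]
  let : Field (R ⧸ p) := Ideal.Quotient.field _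
  have hone : (1 : S ⧸ q) ≠ 0 := one_ne_zero
  have hcong (s : S) (r : R) :
      Ideal.Quotient.mk p r • (1 : S ⧸ q) = Ideal.Quotient.mk q s ↔ s - algebraMap R S r ∈ q := by
    rw [Algebra.smul_def, mul_one, Ideal.Quotient.algebraMap_mk_of_liesOver, eq_comm,
      Ideal.Quotient.eq]
  rw [finrank_eq_one_iff_of_nonzero' (1 : S ⧸ q) hone]
  refine ⟨fun h s ↦ ?_, fun h w ↦ ?_⟩
  · obtain ⟨c, hc⟩ := h (Ideal.Quotient.mk q s)
    obtain ⟨r, rfl⟩ := Ideal.Quotient.mk_surjective c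
    exact ⟨r, (hcong s r).mp hc⟩
  · obtain ⟨s, rfl⟩ := Ideal.Quotient.mk_surjective w
    obtain ⟨r, hr⟩ := h s
    exact ⟨Ideal.Quotient.mk p r, (hcong s r).mpr hr⟩

section TotallyRamified

variable {Γ₀ : Type*} [LinearOrderedCommGroupWithZero Γ₀] {K E : Type u} [Field K] [Valued K Γ₀]
  [Field E] [Algebra K E]

/-- If the integral closure of `𝒪[K]` in `E` is local with residue field that of `K`, then `E / K`
is totally ramified. -/
theorem IsTotallyRamified.of_isLocalRing [IsLocalRing (integralClosure 𝒪[K] E)]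
    (hres : ∀ r : integralClosure 𝒪[K] E, ∃ a : 𝒪[K],
      r - algebraMap 𝒪[K] _ a ∈ IsLocalRing.maximalIdeal (integralClosure 𝒪[K] E)) :
    IsTotallyRamified K E := by
  set P := IsLocalRing.maximalIdeal (integralClosure 𝒪[K] E) with hP
  have hover : P.under 𝒪[K] = 𝓂[K] :=
    IsLocalRing.eq_maximalIdeal (Ideal.isMaximal_comap_of_isIntegral_of_isMaximal P)
  have : P.LiesOver 𝓂[K] := ⟨hover.symm⟩
  refine ⟨P, Set.eq_singleton_iff_unique_mem.mpr ⟨⟨inferInstance, this⟩, ?_⟩, ?_⟩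
  · rintro Q ⟨hQ, hQover⟩
    exact IsLocalRing.eq_maximalIdeal (Ideal.IsMaximal.of_liesOver_isMaximal Q 𝓂[K])
  · exact (inertiaDeg_eq_one_iff 𝓂[K] P).mpr hres

/-- In a totally ramified extension the residue field does not grow. -/
theorem IsTotallyRamified.exists_sub_mem (h : IsTotallyRamified K E)
    [IsLocalRing (integralClosure 𝒪[K] E)] (r : integralClosure 𝒪[K] E) :
    ∃ a : 𝒪[K], r - algebraMap 𝒪[K] _ a ∈ IsLocalRing.maximalIdeal (integralClosure 𝒪[K] E) := by
  obtain ⟨P, hP, hdeg⟩ := h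
  have hmem : P ∈ Ideal.primesOver 𝓂[K] (integralClosure 𝒪[K] E) := by rw [hP]; rfl
  have : P.LiesOver 𝓂[K] := hmem.2
  have : P.IsPrime := hmem.1
  have hPmax : P.IsMaximal := Ideal.IsMaximal.of_liesOver_isMaximal P 𝓂[K]
  obtain ⟨a, ha⟩ := (inertiaDeg_eq_one_iff 𝓂[K] P).mp hdeg r
  exact ⟨a, IsLocalRing.eq_maximalIdeal hPmax ▸ ha⟩

variable [IsDiscreteValuationRing 𝒪[K]] [FiniteDimensional K E] [Algebra.IsSeparable K E]

/-- In a totally ramified extension the integral closure of `𝒪[K]` is a discrete valuation ring. -/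
theorem IsTotallyRamified.isDiscreteValuationRing (h : IsTotallyRamified K E) :
    IsDiscreteValuationRing (integralClosure 𝒪[K] E) := by
  obtain ⟨P, hP, -⟩ := h
  have hDed : IsDedekindDomain (integralClosure 𝒪[K] E) := integralClosure.isDedekindDomain 𝒪[K] K E
  have : IsLocalRing (integralClosure 𝒪[K] E) := by
    obtain ⟨Q, hQ⟩ := Ideal.exists_maximal (integralClosure 𝒪[K] E)
    have key (I : Ideal (integralClosure 𝒪[K] E)) (hI : I.IsMaximal) : I = P := by
      have : I ∈ Ideal.primesOver 𝓂[K] (integralClosure 𝒪[K] E) :=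
        ⟨hI.isPrime, ⟨(IsLocalRing.eq_maximalIdeal
          (Ideal.isMaximal_comap_of_isIntegral_of_isMaximal I)).symm⟩⟩
      rwa [hP] at this
    exact .of_unique_max_ideal ⟨Q, hQ, fun I hI ↦ (key I hI).trans (key Q hQ).symm⟩
  have hinj : Function.Injective (algebraMap 𝒪[K] (integralClosure 𝒪[K] E)) := by
    have : Function.Injective (algebraMap 𝒪[K] E) := by
      rw [IsScalarTower.algebraMap_eq 𝒪[K] K E]
      exact (algebraMap K E).injective.comp Subtype.val_injective
    exact .of_comp (f := algebraMap (integralClosure 𝒪[K] E) E) this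
  have hfield : ¬ IsField (integralClosure 𝒪[K] E) := by
    rw [← Algebra.IsIntegral.isField_iff_isField hinj]
    exact IsDiscreteValuationRing.not_isField _
  exact ((IsDiscreteValuationRing.TFAE _ hfield).out 0 2).mpr hDed

/-- A totally ramified extension `E` of a field `K` with residue field `k` is geometrically
irreducible over `k`. -/
theorem IsTotallyRamified.geometricallyIrreducible (h : IsTotallyRamified K E) {k : Type u} [Field k]
    (φ : k →+* 𝒪[K]) (hφ : ∀ a : 𝒪[K], ∃ c : k, a - φ c ∈ 𝓂[K]) :
    GeometricallyIrreducible (Spec.map (CommRingCat.ofHom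
      ((algebraMap K E).comp ((Valued.v.integer (R := K)).subtype.comp φ)))) := by
  have := h.isDiscreteValuationRing
  algebraize [φ, (algebraMap K E).comp ((Valued.v.integer (R := K)).subtype.comp φ),
    (algebraMap 𝒪[K] (integralClosure 𝒪[K] E)).comp φ]
  have : IsScalarTower k (integralClosure 𝒪[K] E) E := .of_algebraMap_eq fun _ ↦ rfl
  have : IsFractionRing (integralClosure 𝒪[K] E) E :=
    IsIntegralClosure.isFractionRing_of_finite_extension 𝒪[K] K E _
  have hres (r : integralClosure 𝒪[K] E) : ∃ c : k,
      r - algebraMap k _ c ∈ IsLocalRing.maximalIdeal (integralClosure 𝒪[K] E) := by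
    obtain ⟨a, ha⟩ := h.exists_sub_mem r
    obtain ⟨c, hc⟩ := hφ a
    refine ⟨c, ?_⟩
    have hloc : algebraMap 𝒪[K] (integralClosure 𝒪[K] E) (a - φ c) ∈
        IsLocalRing.maximalIdeal (integralClosure 𝒪[K] E) := by
      have hover : (IsLocalRing.maximalIdeal (integralClosure 𝒪[K] E)).under 𝒪[K] = 𝓂[K] :=
        IsLocalRing.eq_maximalIdeal (Ideal.isMaximal_comap_of_isIntegral_of_isMaximal _)
      rwa [← hover] at hc
    convert! add_mem ha hloc using 1
    rw [map_sub]
    exact (sub_add_sub_cancel _ _ _).symm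
  refine ⟨geometrically_iff_of_commRing_of_isClosedUnderIsomorphisms.mpr fun k' _ _ ↦ ?_⟩
  have := isDomain_fractionRing_tensorProduct_of_residue_surjective k' hres E
  have hirr : IrreducibleSpace ↥(Spec (.of (TensorProduct k E k'))) :=
    inferInstanceAs (IrreducibleSpace (PrimeSpectrum (TensorProduct k E k')))
  exact (pullbackSpecIso k E k').hom.homeomorph.irreducibleSpace_iff.mpr hirr

end TotallyRamified

/-! ### Finite extensions of complete valued fields -/

section CompleteValued

variable {Γ₀ Γ₁ : Type*} [LinearOrderedCommGroupWithZero Γ₀] [LinearOrderedCommGroupWithZero Γ₁]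
  {K L : Type u} [Field K] [Field L] [Valued K Γ₀] [Valued L Γ₁] [Algebra K L]

theorem continuousSMul_of_continuous_algebraMap (hcont : Continuous (algebraMap K L)) :
    ContinuousSMul K L := by
  refine ⟨?_⟩
  simp only [Algebra.smul_def]
  exact (hcont.comp continuous_fst).mul continuous_snd

theorem valuation_le_one_of_isIntegral
    (hv : ∀ x : K, Valued.v (algebraMap K L x) ≤ 1 ↔ Valued.v x ≤ 1) {x : L}
    (hx : IsIntegral 𝒪[K] x) : Valued.v x ≤ 1 := by
  let ψ : 𝒪[K] →+* 𝒪[L] := ((algebraMap K L).comp 𝒪[K].subtype).codRestrict 𝒪[L]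
    fun a ↦ (hv a).mpr a.2
  have h2 : IsIntegral 𝒪[L] x := by
    obtain ⟨p, hp, hpx⟩ := hx
    exact ⟨p.map ψ, hp.map ψ, by rw [Polynomial.eval₂_map]; exact hpx⟩
  exact (Valuation.integer.integers (Valued.v (R := L))).mem_of_integral h2

variable [CompleteSpace K] [hrank : (Valued.v : Valuation K Γ₀).RankOne]

/-- A dense finite-dimensional subspace is everything, since finite-dimensional subspaces over a
complete field are closed. -/
theorem eq_top_of_finiteDimensional_of_dense (hcont : Continuous (algebraMap K L))
    (W : Submodule K L) [FiniteDimensional K W] (hW : Dense (W : Set L)) : W = ⊤ := by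
  let : NontriviallyNormedField K := Valued.toNontriviallyNormedField K Γ₀
  have := continuousSMul_of_continuous_algebraMap hcont
  have hclosed : IsClosed (W : Set L) := Submodule.closed_of_finiteDimensional W
  rw [← SetLike.coe_set_eq, ← hclosed.closure_eq, hW.closure_eq, Submodule.top_coe]

/-- The valuation ring of `L`, as an algebra over the valuation ring of `K`. -/
def valuationSubalgebra (hv : ∀ x : K, Valued.v (algebraMap K L x) ≤ 1 ↔ Valued.v x ≤ 1) :
    Subalgebra 𝒪[K] L where
  __ := (Valued.v.integer (R := L)).toSubsemiring
  algebraMap_mem' a := (hv a).mpr a.2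

/-- Elements of the valuation ring of a finite extension of a complete discretely valued field are
integral: in a basis, their coordinates have bounded denominators. -/
theorem isIntegral_of_valuation_le_one [IsDiscreteValuationRing 𝒪[K]] [FiniteDimensional K L]
    (hcont : Continuous (algebraMap K L))
    (hv : ∀ x : K, Valued.v (algebraMap K L x) ≤ 1 ↔ Valued.v x ≤ 1) {x : L}
    (hx : Valued.v x ≤ 1) : IsIntegral 𝒪[K] x := by
  let : NontriviallyNormedField K := Valued.toNontriviallyNormedField K Γ₀
  have := continuousSMul_of_continuous_algebraMap hcont
  set b := Module.finBasis K L
  have hcoord (i) : Continuous (b.coord i) := LinearMap.continuous_of_finiteDimensional _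
  have hU : (⋂ i, b.coord i ⁻¹' (𝒪[K] : Set K)) ∈ nhds (0 : L) := by
    refine (isOpen_iInter_of_finite fun i ↦
      (Valued.isOpen_integer K).preimage (hcoord i)).mem_nhds ?_
    simp
  obtain ⟨γ, hγ⟩ := Valued.mem_nhds_zero.mp hU
  have hγ' : algebraMap K L ⁻¹' {y : L | Valued.v.restrict y < (γ : _)} ∈ nhds (0 : K) :=
    hcont.continuousAt.preimage_mem_nhds (by
      rw [map_zero]; exact Valued.mem_nhds_zero.mpr ⟨γ, subset_rfl⟩)
  obtain ⟨c, hc, hc0⟩ : ∃ c : K, c ∈ algebraMap K L ⁻¹' {y : L | Valued.v.restrict y < (γ : _)} ∧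
      c ≠ 0 := by
    have : (nhdsWithin (0 : K) {0}ᶜ).NeBot := inferInstance
    obtain ⟨c, hc⟩ := this.nonempty_of_mem
      (Filter.inter_mem (mem_nhdsWithin_of_mem_nhds hγ') self_mem_nhdsWithin)
    exact ⟨c, hc.1, hc.2⟩
  let N : Submodule 𝒪[K] L := Submodule.span 𝒪[K] (Set.range fun i ↦ c⁻¹ • b i)
  have hN : N.FG := Submodule.fg_span (Set.finite_range _)
  have hle : Subalgebra.toSubmodule (valuationSubalgebra hv) ≤ N := by
    intro y hy
    have hy1 : Valued.v y ≤ 1 := hy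
    have hcy : c • y ∈ ⋂ i, b.coord i ⁻¹' (𝒪[K] : Set K) := by
      apply hγ
      rw [Set.mem_ofPred_eq, Algebra.smul_def, map_mul]
      refine lt_of_le_of_lt (mul_le_of_le_one_right' ?_) hc
      rw [← map_one (Valued.v (R := L))] at hy1
      simpa using (Valuation.restrict_le_iff _).mpr hy1
    rw [Set.mem_iInter] at hcy
    have hsum : y = ∑ i, (⟨b.coord i (c • y), hcy i⟩ : 𝒪[K]) • (c⁻¹ • b i) := by
      have h1 : ∀ i, (⟨b.coord i (c • y), hcy i⟩ : 𝒪[K]) • (c⁻¹ • b i)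
          = c⁻¹ • (b.repr (c • y) i • b i) := fun i ↦ smul_comm (b.repr (c • y) i) c⁻¹ (b i)
      simp_rw [h1]
      rw [← Finset.smul_sum, b.sum_repr, inv_smul_smul₀ hc0]
    rw [hsum]
    exact Submodule.sum_mem _ fun i _ ↦ Submodule.smul_mem _ _ (Submodule.subset_span ⟨i, rfl⟩)
  exact IsIntegral.of_mem_of_fg (valuationSubalgebra hv) (hN.of_le hle) x hx

/-- A finite extension of complete discretely valued fields whose residue field extension is trivial
is totally ramified. -/
theorem isTotallyRamified_of_residue_surjective [IsDiscreteValuationRing 𝒪[K]]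
    [FiniteDimensional K L] (hcont : Continuous (algebraMap K L))
    (hv : ∀ x : K, Valued.v (algebraMap K L x) ≤ 1 ↔ Valued.v x ≤ 1)
    (hres : ∀ x : L, Valued.v x ≤ 1 → ∃ a : 𝒪[K], Valued.v (x - algebraMap K L a) < 1) :
    IsTotallyRamified K L := by
  have hmem (x : L) : x ∈ integralClosure 𝒪[K] L ↔ Valued.v x ≤ 1 :=
    ⟨valuation_le_one_of_isIntegral hv, isIntegral_of_valuation_le_one hcont hv⟩
  let e : 𝒪[L] ≃+* integralClosure 𝒪[K] L :=
    RingEquiv.subsemiringCongr (s := 𝒪[L].toSubsemiring)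
      (t := (integralClosure 𝒪[K] L).toSubsemiring) (by ext x; exact (hmem x).symm)
  have : IsLocalRing (integralClosure 𝒪[K] L) := e.isLocalRing
  refine .of_isLocalRing fun r ↦ ?_
  obtain ⟨a, ha⟩ := hres r ((hmem r).mp r.2)
  refine ⟨a, (IsLocalRing.mem_maximalIdeal _).mpr fun hu ↦ ?_⟩
  obtain ⟨s, hs⟩ := hu.exists_right_inv
  have h1 : Valued.v ((r : L) - algebraMap K L a) * Valued.v (s : L) = 1 := by
    rw [← map_mul, ← map_one (Valued.v (R := L))]
    exact congrArg (fun t : integralClosure 𝒪[K] L ↦ Valued.v (t : L)) hs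
  exact absurd h1 (mul_lt_one_of_lt_of_le ha ((hmem s).mp s.2)).ne

end CompleteValued

/-! ### Completions of extensions of Dedekind domains -/

theorem mem_maximalIdeal_integer_iff {Γ₀ K : Type*} [LinearOrderedCommGroupWithZero Γ₀] [Field K]
    [Valued K Γ₀] {a : 𝒪[K]} : a ∈ 𝓂[K] ↔ Valued.v (a : K) < 1 := by
  rw [IsLocalRing.mem_maximalIdeal, mem_nonunits_iff,
    Valuation.Integer.not_isUnit_iff_valuation_lt_one]

section AdicCompletion

variable {A K : Type u} [CommRing A] [IsDedekindDomain A] [Field K] [Algebra A K]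
  [IsFractionRing A K] (v : HeightOneSpectrum A)

/-- Completing does not enlarge the residue field. -/
theorem exists_valuation_sub_algebraMap_lt_one {x : v.adicCompletion K} (hx : Valued.v x ≤ 1) :
    ∃ a : A, Valued.v (x - algebraMap A (v.adicCompletion K) a) < 1 := by
  have hopen : IsOpen {y : v.adicCompletion K | Valued.v (x - y) < 1} := by
    have h1 : IsOpen {z : v.adicCompletion K | Valued.v z < 1} := by
      simpa using Valued.isOpen_ball (v.adicCompletion K) 1
    exact h1.preimage (continuous_const.sub continuous_id)
  obtain ⟨y, hy⟩ := (denseRange_algebraMap K v).exists_mem_open hopen ⟨x, by simp⟩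
  have hvy : Valued.v (algebraMap K (v.adicCompletion K) y) = v.valuation K y :=
    valuedAdicCompletion_eq_valuation' v y
  have hy1 : v.valuation K y ≤ 1 := by
    rw [← hvy, ← sub_sub_cancel x (algebraMap K (v.adicCompletion K) y)]
    exact (Valuation.map_sub _ _ _).trans (max_le hx (le_of_lt hy))
  obtain ⟨a, ha⟩ := v.exists_valuation_sub_lt_of_integer hy1 1
  refine ⟨a, ?_⟩
  rw [Valuation.map_sub_swap, ← valuedAdicCompletion_eq_valuation' v] at ha
  have hsum : x - algebraMap A (v.adicCompletion K) a = (x - algebraMap K (v.adicCompletion K) y) +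
      algebraMap K (v.adicCompletion K) (y - algebraMap A K a) := by
    rw [map_sub, ← IsScalarTower.algebraMap_apply, sub_add_sub_cancel]
  rw [hsum]
  exact Valuation.map_add_lt _ hy ha

theorem isLocalField_adicCompletion [Finite (A ⧸ v.asIdeal)] :
    IsLocalField (v.adicCompletion K) := by
  have hdvr : IsDiscreteValuationRing 𝒪[v.adicCompletion K] :=
    inferInstanceAs (IsDiscreteValuationRing (v.adicCompletionIntegers K))
  refine ⟨inferInstance, hdvr, ?_⟩
  let ψ : A →+* 𝒪[v.adicCompletion K] :=
    (algebraMap A (v.adicCompletion K)).codRestrict 𝒪[v.adicCompletion K]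
      fun a ↦ coe_mem_adicCompletionIntegers v a
  let ψ' : A ⧸ v.asIdeal →+* 𝓀[v.adicCompletion K] :=
    Ideal.Quotient.lift v.asIdeal ((IsLocalRing.residue _).comp ψ) fun a ha ↦ by
      rw [RingHom.comp_apply, IsLocalRing.residue_eq_zero_iff, mem_maximalIdeal_integer_iff]
      exact (valuedAdicCompletion_eq_valuation v a).trans_lt ((v.valuation_lt_one_iff_mem a).mpr ha)
  refine Finite.of_surjective ψ' fun z ↦ ?_
  obtain ⟨x, rfl⟩ := IsLocalRing.residue_surjective z
  obtain ⟨a, ha⟩ := exists_valuation_sub_algebraMap_lt_one v x.2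
  refine ⟨Ideal.Quotient.mk _ a, ?_⟩
  rw [Ideal.Quotient.lift_mk, eq_comm, RingHom.comp_apply, ← sub_eq_zero, ← map_sub,
    IsLocalRing.residue_eq_zero_iff, mem_maximalIdeal_integer_iff]
  exact ha

variable {B L : Type u} [CommRing B]
  [IsDedekindDomain B] [Algebra A B] [Module.IsTorsionFree A B] [Field L]
  [Algebra K L] [Algebra A L] [IsScalarTower A K L]
  [Algebra B L] [IsFractionRing B L] [IsScalarTower A B L]
  (w : HeightOneSpectrum B) [w.asIdeal.LiesOver v.asIdeal]

theorem continuous_adicCompletionMap :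
    Continuous (adicCompletionMap v w : v.adicCompletion K →+* w.adicCompletion L) :=
  (adicCompletion.continuous_ofCompletion L w).comp
    (UniformSpace.Completion.continuous_map.comp (adicCompletion.continuous_toCompletion K v))

theorem adicCompletionMap_algebraMap (x : K) :
    adicCompletionMap v w (algebraMap K (v.adicCompletion K) x) =
      algebraMap L (w.adicCompletion L) (algebraMap K L x) := by
  apply adicCompletion.ext
  exact UniformSpace.Completion.mapRingHom_coe
    (uniformContinuous_algebraMap_liesOver K L v w).continuous _

/-- The valuations of the completions are compatible: both conditions are clopen, and they are
equivalent on the dense subfield `K`, where one valuation is a power of the other. -/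
theorem valued_adicCompletionMap_le_one_iff (x : v.adicCompletion K) :
    Valued.v (adicCompletionMap v w x : w.adicCompletion L) ≤ 1 ↔ Valued.v x ≤ 1 := by
  have h1 : IsClopen {x : v.adicCompletion K | Valued.v x ≤ 1} :=
    Valued.isClopen_integer (v.adicCompletion K)
  have h2 : IsClopen {x : v.adicCompletion K |
      Valued.v (adicCompletionMap v w x : w.adicCompletion L) ≤ 1} :=
    (Valued.isClopen_integer (w.adicCompletion L)).preimage (continuous_adicCompletionMap v w)
  have hK (y : K) : Valued.v (adicCompletionMap v w (algebraMap K (v.adicCompletion K) y) :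
      w.adicCompletion L) ≤ 1 ↔ Valued.v (algebraMap K (v.adicCompletion K) y) ≤ 1 := by
    have hL : Valued.v (algebraMap L (w.adicCompletion L) (algebraMap K L y)) =
        w.valuation L (algebraMap K L y) := valuedAdicCompletion_eq_valuation' w _
    have hK : Valued.v (algebraMap K (v.adicCompletion K) y) = v.valuation K y :=
      valuedAdicCompletion_eq_valuation' v y
    rw [adicCompletionMap_algebraMap, hL, hK, ← valuation_liesOver L v w,
      pow_le_one_iff
        (Ideal.IsDedekindDomain.ramificationIdx'_ne_zero_of_liesOver w.asIdeal v.ne_bot)]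
  have h3 : IsClopen ({x : v.adicCompletion K |
      Valued.v (adicCompletionMap v w x : w.adicCompletion L) ≤ 1 ↔ Valued.v x ≤ 1}) := by
    convert! (h2.inter h1).union (h2.compl.inter h1.compl) using 1
    ext x
    simp only [Set.mem_ofPred_eq, Set.mem_union, Set.mem_inter_iff, Set.mem_compl_iff]
    tauto
  exact h3.isClosed.closure_subset_iff.mpr (Set.range_subset_iff.mpr hK)
    ((denseRange_algebraMap K v) x)

end AdicCompletion

/-! ### Extensions generated by a subfield -/

section Compositum

variable (K₀ L₀ K L : Type u) [Field K₀] [Field L₀] [Field K] [Field L] [Algebra K₀ L₀]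
  [Algebra K₀ K] [Algebra L₀ L] [Algebra K L] [Algebra K₀ L] [IsScalarTower K₀ L₀ L]
  [IsScalarTower K₀ K L]

theorem finiteDimensional_span_range_algebraMap [FiniteDimensional K₀ L₀] :
    FiniteDimensional K (Submodule.span K (Set.range (algebraMap L₀ L))) := by
  obtain ⟨s, hs⟩ := Module.Finite.fg_top (R := K₀) (M := L₀)
  have hrange : Set.range (algebraMap L₀ L) =
      Submodule.span K₀ (algebraMap L₀ L '' s) := by
    have h := Submodule.map_span (IsScalarTower.toAlgHom K₀ L₀ L).toLinearMap (s : Set L₀)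
    rw [hs] at h
    have h' := congrArg (fun N : Submodule K₀ L ↦ (N : Set L)) h
    simp only [Submodule.map_top, LinearMap.coe_range] at h'
    exact h'
  rw [hrange, Submodule.span_span_of_tower]
  exact FiniteDimensional.span_of_finite K ((Finset.finite_toSet s).image _)

variable (htop : Submodule.span K (Set.range (algebraMap L₀ L)) = ⊤)
include htop

theorem isSeparable_of_span_range_algebraMap_eq_top [Algebra.IsSeparable K₀ L₀] :
    Algebra.IsSeparable K L := by
  rw [← separableClosure.eq_top_iff, eq_top_iff]
  intro x _
  have hle : Submodule.span K (Set.range (algebraMap L₀ L)) ≤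
      Subalgebra.toSubmodule (separableClosure K L).toSubalgebra := by
    rw [Submodule.span_le]
    rintro _ ⟨y, rfl⟩
    have hy : IsSeparable K₀ (algebraMap L₀ L y) :=
      IsSeparable.map (f := IsScalarTower.toAlgHom K₀ L₀ L) (algebraMap L₀ L).injective
        (Algebra.IsSeparable.isSeparable K₀ y)
    exact mem_separableClosure_iff.mpr (hy.tower_top K)
  exact hle (htop ▸ Submodule.mem_top)

theorem algHom_ext_of_span_range_algebraMap_eq_top {E : Type*} [Field E] [Algebra K E]
    {a b : L →ₐ[K] E} (h : ∀ x : L₀, a (algebraMap L₀ L x) = b (algebraMap L₀ L x)) : a = b := by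
  have : a.toLinearMap = b.toLinearMap :=
    LinearMap.ext_on_range (v := algebraMap L₀ L) htop h
  exact AlgHom.toLinearMap_injective this

end Compositum

theorem isSeparable_galoisClosure (K L : Type u) [Field K] [Field L] [Algebra K L]
    [Algebra.IsSeparable K L] : Algebra.IsSeparable K (galoisClosure K L) := by
  rw [← le_separableClosure_iff]
  refine normalClosure_le_iff.mpr fun i ↦ ?_
  have : Algebra.IsSeparable K i.fieldRange :=
    AlgEquiv.Algebra.isSeparable (AlgEquiv.ofInjectiveField i)
  exact le_separableClosure K _ _

/-! ### The local criterion -/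

section LocalCriterion

variable {A K B L : Type u} [CommRing A] [IsDedekindDomain A] [Field K] [Algebra A K]
  [IsFractionRing A K] [CommRing B] [IsDedekindDomain B] [Algebra A B] [Module.IsTorsionFree A B]
  [Field L] [Algebra K L] [Algebra A L] [IsScalarTower A K L] [Algebra B L] [IsFractionRing B L]
  [IsScalarTower A B L] [FiniteDimensional K L] [Algebra.IsSeparable K L]
  (v : HeightOneSpectrum A) (w : HeightOneSpectrum B) [w.asIdeal.LiesOver v.asIdeal]

/-- Let `w` lie over `v`, both with the finite residue field `k`. If any two embeddings of `L` over
`K` into a common field `M` that is geometrically irreducible over `k` agree, then the completion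
`L_w / K_v` is exceptional: for `σ` outside `Gal(N/L_w)` the embedding of `L` into `L_w` and its
composition with `σ` are different embeddings into the compositum of `L_w` and `σ(L_w)`. -/
theorem isExceptionalLocalEmbedding_adicCompletionMap {k : Type u} [Field k] [Finite k]
    (φ : k →+* A) (hA : ∀ a : A, ∃ c : k, a - φ c ∈ v.asIdeal)
    (hB : ∀ b : B, ∃ c : k, b - algebraMap A B (φ c) ∈ w.asIdeal)
    (hmain : ∀ (M : Type u) [Field M] (a b : L →+* M),
      a.comp (algebraMap K L) = b.comp (algebraMap K L) →
      GeometricallyIrreducible (Spec.map (CommRingCat.ofHom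
        (a.comp ((algebraMap K L).comp ((algebraMap A K).comp φ))))) → a = b) :
    IsExceptionalLocalEmbedding
      (adicCompletionMap v w : v.adicCompletion K →+* w.adicCompletion L) := by
  let : Algebra (v.adicCompletion K) (w.adicCompletion L) := (adicCompletionMap v w).toAlgebra
  change IsExceptionalLocalExtension (v.adicCompletion K) (w.adicCompletion L)
  have : IsScalarTower K (v.adicCompletion K) (w.adicCompletion L) := .of_algebraMap_eq fun x ↦
    (IsScalarTower.algebraMap_apply K L (w.adicCompletion L) x).trans
      (adicCompletionMap_algebraMap v w x).symm
  have hfinA : Finite (A ⧸ v.asIdeal) :=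
    Finite.of_surjective (fun c : k ↦ Ideal.Quotient.mk v.asIdeal (φ c)) fun z ↦ by
      obtain ⟨a, rfl⟩ := Ideal.Quotient.mk_surjective z
      obtain ⟨c, hc⟩ := hA a
      exact ⟨c, (Ideal.Quotient.eq.mpr hc).symm⟩
  have hfinB : Finite (B ⧸ w.asIdeal) :=
    Finite.of_surjective (fun c : k ↦ Ideal.Quotient.mk w.asIdeal (algebraMap A B (φ c))) fun z ↦ by
      obtain ⟨b, rfl⟩ := Ideal.Quotient.mk_surjective z
      obtain ⟨c, hc⟩ := hB b
      exact ⟨c, (Ideal.Quotient.eq.mpr hc).symm⟩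
  have hKv : IsLocalField (v.adicCompletion K) := isLocalField_adicCompletion v
  have := hKv.discrete
  have hcont : Continuous (algebraMap (v.adicCompletion K) (w.adicCompletion L)) :=
    continuous_adicCompletionMap v w
  have hv : ∀ x : v.adicCompletion K,
      Valued.v (algebraMap (v.adicCompletion K) (w.adicCompletion L) x) ≤ 1 ↔ Valued.v x ≤ 1 :=
    valued_adicCompletionMap_le_one_iff v w
  let : (Valued.v : Valuation (v.adicCompletion K) ℤᵐ⁰).RankOne :=
    Valuation.IsRankOneDiscrete.rankOne _ one_lt_two
  have := finiteDimensional_span_range_algebraMap K L (v.adicCompletion K) (w.adicCompletion L)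
  have htop : Submodule.span (v.adicCompletion K)
      (Set.range (algebraMap L (w.adicCompletion L))) = ⊤ :=
    eq_top_of_finiteDimensional_of_dense hcont _
      ((denseRange_algebraMap L w).mono Submodule.subset_span)
  have hfin : FiniteDimensional (v.adicCompletion K) (w.adicCompletion L) := by
    rw [htop] at this
    exact Module.Finite.equiv (Submodule.topEquiv (R := v.adicCompletion K))
  have hsep : Algebra.IsSeparable (v.adicCompletion K) (w.adicCompletion L) :=
    isSeparable_of_span_range_algebraMap_eq_top K L _ _ htop
  -- the constants `k` inside the valuation ring of the completion at `v`
  let φv : k →+* 𝒪[v.adicCompletion K] :=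
    ((algebraMap A (v.adicCompletion K)).comp φ).codRestrict 𝒪[v.adicCompletion K]
      fun c ↦ coe_mem_adicCompletionIntegers v (φ c)
  have hφv (a : 𝒪[v.adicCompletion K]) : ∃ c : k, a - φv c ∈ 𝓂[v.adicCompletion K] := by
    obtain ⟨r, hr⟩ := exists_valuation_sub_algebraMap_lt_one v a.2
    obtain ⟨c, hc⟩ := hA r
    refine ⟨c, mem_maximalIdeal_integer_iff.mpr ?_⟩
    have hc' : Valued.v (algebraMap A (v.adicCompletion K) (r - φ c)) < 1 :=
      (valuedAdicCompletion_eq_valuation v _).trans_lt ((v.valuation_lt_one_iff_mem _).mpr hc)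
    rw [map_sub] at hc'
    have := Valuation.map_add_lt _ hr hc'
    rwa [sub_add_sub_cancel] at this
  have hres (x : w.adicCompletion L) (hx : Valued.v x ≤ 1) : ∃ a : 𝒪[v.adicCompletion K],
      Valued.v (x - algebraMap (v.adicCompletion K) (w.adicCompletion L) a) < 1 := by
    obtain ⟨r, hr⟩ := exists_valuation_sub_algebraMap_lt_one w hx
    obtain ⟨c, hc⟩ := hB r
    refine ⟨φv c, ?_⟩
    have hc' : Valued.v (algebraMap B (w.adicCompletion L) (r - algebraMap A B (φ c))) < 1 :=
      (valuedAdicCompletion_eq_valuation w _).trans_lt ((w.valuation_lt_one_iff_mem _).mpr hc)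
    have hφc : algebraMap (v.adicCompletion K) (w.adicCompletion L) (φv c) =
        algebraMap B (w.adicCompletion L) (algebraMap A B (φ c)) := by
      have h1 : (φv c : v.adicCompletion K) =
          algebraMap K (v.adicCompletion K) (algebraMap A K (φ c)) :=
        IsScalarTower.algebraMap_apply A K (v.adicCompletion K) (φ c)
      rw [h1, ← IsScalarTower.algebraMap_apply K, IsScalarTower.algebraMap_apply K L,
        ← IsScalarTower.algebraMap_apply A K L, IsScalarTower.algebraMap_apply A B L,
        ← IsScalarTower.algebraMap_apply B L]
    rw [map_sub, ← hφc] at hc'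
    have := Valuation.map_add_lt _ hr hc'
    rwa [sub_add_sub_cancel] at this
  refine ⟨hKv, isLocalField_adicCompletion w, hv, hfin, hsep,
    isTotallyRamified_of_residue_surjective hcont hv hres, fun σ hσ hram ↦ hσ ?_⟩
  have := isSeparable_galoisClosure (v.adicCompletion K) (w.adicCompletion L)
  have : FiniteDimensional (v.adicCompletion K)
      (galoisClosure (v.adicCompletion K) (w.adicCompletion L)) :=
    normalClosure.is_finiteDimensional _ _ _
  -- the two embeddings into the compositum: the inclusion, and `σ` after the inclusion
  let ι := IsScalarTower.toAlgHom (v.adicCompletion K) (w.adicCompletion L)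
    (galoisClosure (v.adicCompletion K) (w.adicCompletion L))
  let M := baseInGaloisClosure (v.adicCompletion K) (w.adicCompletion L) ⊔
    (baseInGaloisClosure (v.adicCompletion K) (w.adicCompletion L)).map σ.toAlgHom
  have ha (x : w.adicCompletion L) : ι x ∈ M :=
    (le_sup_left : _ ≤ M) ⟨x, rfl⟩
  have hb (x : w.adicCompletion L) : σ (ι x) ∈ M :=
    (le_sup_right : _ ≤ M) ⟨ι x, ⟨x, rfl⟩, rfl⟩
  let a : w.adicCompletion L →ₐ[v.adicCompletion K] M := ι.codRestrict M.toSubalgebra ha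
  let b : w.adicCompletion L →ₐ[v.adicCompletion K] M :=
    (σ.toAlgHom.comp ι).codRestrict M.toSubalgebra hb
  have hbase (i : w.adicCompletion L →ₐ[v.adicCompletion K] M) (x : K) :
      i (algebraMap L (w.adicCompletion L) (algebraMap K L x)) =
        algebraMap (v.adicCompletion K) M (algebraMap K (v.adicCompletion K) x) := by
    rw [← IsScalarTower.algebraMap_apply K L, IsScalarTower.algebraMap_apply K (v.adicCompletion K),
      AlgHom.commutes]
  have hab := hmain M ((a : w.adicCompletion L →+* M).comp (algebraMap L (w.adicCompletion L)))
    ((b : w.adicCompletion L →+* M).comp (algebraMap L (w.adicCompletion L)))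
    (RingHom.ext fun x ↦ (hbase a x).trans (hbase b x).symm) (by
      have hconst : ((a : w.adicCompletion L →+* M).comp (algebraMap L (w.adicCompletion L))).comp
          ((algebraMap K L).comp ((algebraMap A K).comp φ)) =
          (algebraMap (v.adicCompletion K) M).comp
            ((Valued.v.integer (R := v.adicCompletion K)).subtype.comp φv) :=
        RingHom.ext fun c ↦ hbase a (algebraMap A K (φ c))
      rw [hconst]
      exact hram.geometricallyIrreducible φv hφv)
  have heq : ι = σ.toAlgHom.comp ι :=
    algHom_ext_of_span_range_algebraMap_eq_top L _ _ htop fun x ↦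
      congrArg Subtype.val (RingHom.congr_fun hab x)
  rw [IntermediateField.mem_fixingSubgroup_iff]
  rintro _ ⟨x, rfl⟩
  exact (DFunLike.congr_fun heq x).symm

end LocalCriterion

/-! ### Function fields and rational points of curves -/

namespace Curve

variable {k : Type u} [Field k] {X Y : Curve k}

theorem functionFieldMap_germToFunctionField (f : X.toScheme ⟶ Y.toScheme) [IsFinite f]
    (U : Y.toScheme.Opens) [Nonempty U] [Nonempty (f ⁻¹ᵁ U)] (a : Γ(Y.toScheme, U)) :
    functionFieldMap f (Y.toScheme.germToFunctionField U a) =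
      X.toScheme.germToFunctionField (f ⁻¹ᵁ U) (f.app U a) := by
  have hU : genericPoint Y.toScheme ∈ U :=
    ((genericPoint_spec Y.toScheme).mem_open_set_iff U.isOpen).mpr (by simpa using ‹Nonempty U›)
  have hU' : f (genericPoint X.toScheme) ∈ U := by rwa [map_genericPoint]
  have h1 := Y.toScheme.presheaf.germ_stalkSpecializes hU
    (specializes_of_eq (map_genericPoint f))
  have h2 := f.germ_stalkMap U (genericPoint X.toScheme) hU'
  have h3 : Y.toScheme.presheaf.germ U _ hU ≫
      (Y.toScheme.presheaf.stalkSpecializes (specializes_of_eq (map_genericPoint f)) ≫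
        f.stalkMap (genericPoint X.toScheme)) =
      f.app U ≫ X.toScheme.presheaf.germ (f ⁻¹ᵁ U) _ hU' := by
    rw [← Category.assoc, h1, h2]
  exact ConcreteCategory.congr_hom h3 a

/-- The function field extension of a finite morphism of curves is finite. -/
theorem finite_functionFieldMap (f : X.toScheme ⟶ Y.toScheme) [IsFinite f] :
    (functionFieldMap f).Finite := by
  obtain ⟨_, ⟨U, hU, rfl⟩, hηU, -⟩ := Y.toScheme.isBasis_affineOpens.exists_subset_of_mem_open
    (Set.mem_univ (genericPoint Y.toScheme)) isOpen_univ
  have : Nonempty U := ⟨⟨_, hηU⟩⟩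
  have : Nonempty (f ⁻¹ᵁ U) := ⟨⟨genericPoint X.toScheme, by
    change f (genericPoint X.toScheme) ∈ U; rwa [map_genericPoint]⟩⟩
  have hfin : (f.app U).hom.Finite := IsFinite.finite_app f U hU
  have := functionField_isFractionRing_of_isAffineOpen Y.toScheme U hU
  have := functionField_isFractionRing_of_isAffineOpen X.toScheme (f ⁻¹ᵁ U) (hU.preimage f)
  algebraize [functionFieldMap f, (f.app U).hom,
    (functionFieldMap f).comp (algebraMap Γ(Y.toScheme, U) Y.toScheme.functionField)]
  have : IsScalarTower Γ(Y.toScheme, U) Γ(X.toScheme, f ⁻¹ᵁ U) X.toScheme.functionField :=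
    .of_algebraMap_eq fun a ↦ functionFieldMap_germToFunctionField f U a
  have : FaithfulSMul Γ(Y.toScheme, U) Γ(X.toScheme, f ⁻¹ᵁ U) := by
    rw [faithfulSMul_iff_algebraMap_injective]
    refine .of_comp (f := algebraMap Γ(X.toScheme, f ⁻¹ᵁ U) X.toScheme.functionField) ?_
    rw [← RingHom.coe_comp, ← IsScalarTower.algebraMap_eq,
      IsScalarTower.algebraMap_eq _ Y.toScheme.functionField]
    exact (functionFieldMap f).injective.comp (IsFractionRing.injective _ _)
  exact Module.Finite.of_isLocalization Γ(Y.toScheme, U) Γ(X.toScheme, f ⁻¹ᵁ U)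
    (nonZeroDivisors Γ(Y.toScheme, U))

/-- The inclusion of the constants in the local ring of a curve at a point. -/
noncomputable def stalkStr (X : Curve k) (x : X.toScheme) : k →+* X.toScheme.presheaf.stalk x :=
  (Spec.preimage (X.toScheme.fromSpecStalk x ≫ X.str)).hom

theorem SpecMap_stalkStr (X : Curve k) (x : X.toScheme) :
    Spec.map (CommRingCat.ofHom (X.stalkStr x)) = X.toScheme.fromSpecStalk x ≫ X.str :=
  Spec.map_preimage _

theorem localRingMap_stalkStr (f : X.toScheme ⟶ Y.toScheme) [IsFinite f] (hf : f ≫ Y.str = X.str)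
    (x : X.Place) (c : k) : localRingMap f x (Y.stalkStr _ c) = X.stalkStr x.1 c := by
  have h : CommRingCat.ofHom (Y.stalkStr (f x.1)) ≫ f.stalkMap x.1 =
      CommRingCat.ofHom (X.stalkStr x.1) := by
    apply Spec.map_injective
    rw [Spec.map_comp, SpecMap_stalkStr, SpecMap_stalkStr, Scheme.SpecMap_stalkMap_fromSpecStalk_assoc,
      hf]
  exact ConcreteCategory.congr_hom h c

/-- At a rational point, every element of the local ring is congruent to a constant, namely to its
value at the point. -/
theorem RationalPoint.exists_sub_mem_maximalIdeal (P : X.RationalPoint)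
    (b : X.toScheme.presheaf.stalk P.place.1) :
    ∃ c : k, b - X.stalkStr P.place.1 c ∈
      IsLocalRing.maximalIdeal (X.toScheme.presheaf.stalk P.place.1) := by
  let ψ : X.toScheme.presheaf.stalk P.place.1 ⟶ .of k := Scheme.stalkClosedPointTo P.hom
  have hψ : IsLocalHom ψ.hom := Scheme.isLocalHom_stalkClosedPointTo' P.hom
  have hid : CommRingCat.ofHom (X.stalkStr P.place.1) ≫ ψ = 𝟙 _ := by
    apply Spec.map_injective
    rw [Spec.map_comp, SpecMap_stalkStr, ← Category.assoc, Spec.map_id, ← P.hom_str]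
    congr 1
    exact Scheme.Spec_stalkClosedPointTo_fromSpecStalk P.hom
  refine ⟨ψ.hom b, (IsLocalRing.mem_maximalIdeal _).mpr fun hu ↦ ?_⟩
  have h0 : ψ.hom (X.stalkStr P.place.1 (ψ.hom b)) = ψ.hom b :=
    ConcreteCategory.congr_hom hid (ψ.hom b)
  have := hu.map ψ.hom
  rw [map_sub, h0, sub_self] at this
  exact not_isUnit_zero this

theorem SpecMap_functionFieldMap_fromSpecStalk (f : X.toScheme ⟶ Y.toScheme) [IsFinite f] :
    Spec.map (CommRingCat.ofHom (functionFieldMap f)) ≫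
      Y.toScheme.fromSpecStalk (genericPoint Y.toScheme) =
    X.toScheme.fromSpecStalk (genericPoint X.toScheme) ≫ f := by
  rw [functionFieldMap, CommRingCat.ofHom_hom, Spec.map_comp, Category.assoc,
    Scheme.SpecMap_stalkSpecializes_fromSpecStalk, Scheme.SpecMap_stalkMap_fromSpecStalk]

theorem SpecMap_algebraMap_fromSpecStalk (X : Curve k) (x : X.toScheme) :
    Spec.map (CommRingCat.ofHom
      (algebraMap (X.toScheme.presheaf.stalk x) X.toScheme.functionField)) ≫
      X.toScheme.fromSpecStalk x = X.toScheme.fromSpecStalk (genericPoint X.toScheme) :=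
  Scheme.SpecMap_stalkSpecializes_fromSpecStalk
    ((genericPoint_spec X.toScheme).specializes trivial)

/-- For an exceptional cover `f : X → Y`, two embeddings of `k(X)` over `k(Y)` into a common field
that is geometrically irreducible over `k` agree. -/
theorem IsExceptionalCover.embedding_eq {f : X.toScheme ⟶ Y.toScheme} [IsFinite f]
    (hexc : IsExceptionalCover f) (hf : f ≫ Y.str = X.str) (y : Y.toScheme) {M : Type u} [Field M]
    (a b : X.toScheme.functionField →+* M)
    (hab : a.comp (functionFieldMap f) = b.comp (functionFieldMap f))
    (hgeom : GeometricallyIrreducible (Spec.map (CommRingCat.ofHom (a.comp ((functionFieldMap f).comp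
      ((algebraMap (Y.toScheme.presheaf.stalk y) Y.toScheme.functionField).comp
        (Y.stalkStr y))))))) : a = b := by
  have hcomp (i : X.toScheme.functionField →+* M) :
      (Spec.map (CommRingCat.ofHom i) ≫ X.toScheme.fromSpecStalk (genericPoint X.toScheme)) ≫ f =
        Spec.map (CommRingCat.ofHom (i.comp (functionFieldMap f))) ≫
          Y.toScheme.fromSpecStalk (genericPoint Y.toScheme) := by
    rw [CommRingCat.ofHom_comp, Spec.map_comp, Category.assoc, Category.assoc,
      SpecMap_functionFieldMap_fromSpecStalk]
  have hstr : (Spec.map (CommRingCat.ofHom a) ≫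
      X.toScheme.fromSpecStalk (genericPoint X.toScheme)) ≫ X.str =
      Spec.map (CommRingCat.ofHom (a.comp ((functionFieldMap f).comp
        ((algebraMap (Y.toScheme.presheaf.stalk y) Y.toScheme.functionField).comp
          (Y.stalkStr y))))) := by
    rw [← hf, ← Category.assoc, hcomp, ← SpecMap_algebraMap_fromSpecStalk Y y, Category.assoc,
      Category.assoc, ← SpecMap_stalkStr, ← Spec.map_comp, ← Spec.map_comp]
    rfl
  rw [← hstr] at hgeom
  let x : ↥(Spec (CommRingCat.of M)) := IsLocalRing.closedPoint M
  have hx : (Spec.map (CommRingCat.ofHom a) ≫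
      X.toScheme.fromSpecStalk (genericPoint X.toScheme)) x = genericPoint X.toScheme := by
    have : Subsingleton ↥(Spec (X.toScheme.presheaf.stalk (genericPoint X.toScheme))) :=
      inferInstanceAs (Subsingleton (PrimeSpectrum X.toScheme.functionField))
    rw [Scheme.Hom.comp_apply, Subsingleton.elim (Spec.map (CommRingCat.ofHom a) x)
      (IsLocalRing.closedPoint (X.toScheme.presheaf.stalk (genericPoint X.toScheme))),
      Scheme.fromSpecStalk_closedPoint]
  have heq := hexc.eq_of_comp_eq _ (Spec.map (CommRingCat.ofHom b) ≫
    X.toScheme.fromSpecStalk (genericPoint X.toScheme)) (by rw [hcomp, hcomp, hab]) x hx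
  rw [cancel_mono] at heq
  exact congrArg CommRingCat.Hom.hom (Spec.map_injective heq)

end Curve

theorem theorem3p3 {k : Type u} [Field k] [Finite k] (X Y : Curve k)
    (f : X.toScheme ⟶ Y.toScheme) (hf : f ≫ Y.str = X.str) [IsFinite f]
    (hsep : Curve.IsSeparableMorphism f) (hexc : Curve.IsExceptionalCover f)
    (u : X.RationalPoint) :
    IsExceptionalLocalEmbedding (Curve.completionMap f u.place) := by
  -- the algebra structures in the definition of `Curve.completionMap`
  let : Algebra Y.toScheme.functionField X.toScheme.functionField :=
    (Curve.functionFieldMap f).toAlgebra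
  let : Algebra (Y.toScheme.presheaf.stalk (u.place.map f).1)
      (X.toScheme.presheaf.stalk u.place.1) := (Curve.localRingMap f u.place).toAlgebra
  let : Algebra (Y.toScheme.presheaf.stalk (u.place.map f).1) X.toScheme.functionField :=
    ((algebraMap (X.toScheme.presheaf.stalk u.place.1) X.toScheme.functionField).comp
      (Curve.localRingMap f u.place)).toAlgebra
  have : IsScalarTower (Y.toScheme.presheaf.stalk (u.place.map f).1)
    (X.toScheme.presheaf.stalk u.place.1) X.toScheme.functionField := .of_algebraMap_eq fun _ ↦ rfl
  have : IsScalarTower (Y.toScheme.presheaf.stalk (u.place.map f).1) Y.toScheme.functionField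
    X.toScheme.functionField :=
    .of_algebraMap_eq fun a ↦ (Curve.functionFieldMap_algebraMap f u.place a).symm
  have : Module.IsTorsionFree (Y.toScheme.presheaf.stalk (u.place.map f).1)
      (X.toScheme.presheaf.stalk u.place.1) := by
    rw [Module.isTorsionFree_iff_algebraMap_injective]
    exact Curve.localRingMap_injective f u.place
  have : (IsDiscreteValuationRing.maximalIdeal
      (X.toScheme.presheaf.stalk u.place.1)).asIdeal.LiesOver
      (IsDiscreteValuationRing.maximalIdeal
        (Y.toScheme.presheaf.stalk (u.place.map f).1)).asIdeal :=
    ⟨(IsLocalRing.maximalIdeal_comap (Curve.localRingMap f u.place)).symm⟩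
  have : FiniteDimensional Y.toScheme.functionField X.toScheme.functionField :=
    Curve.finite_functionFieldMap f
  have : Algebra.IsSeparable Y.toScheme.functionField X.toScheme.functionField := hsep
  have hB (b : X.toScheme.presheaf.stalk u.place.1) : ∃ c : k,
      b - Curve.localRingMap f u.place (Y.stalkStr _ c) ∈
        IsLocalRing.maximalIdeal (X.toScheme.presheaf.stalk u.place.1) := by
    simp only [Curve.localRingMap_stalkStr f hf]
    exact u.exists_sub_mem_maximalIdeal b
  refine isExceptionalLocalEmbedding_adicCompletionMap
    (IsDiscreteValuationRing.maximalIdeal (Y.toScheme.presheaf.stalk (u.place.map f).1))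
    (IsDiscreteValuationRing.maximalIdeal (X.toScheme.presheaf.stalk u.place.1))
    (Y.stalkStr (u.place.map f).1) (fun a ↦ ?_) hB
    fun M _ a b hab hgeom ↦ hexc.embedding_eq hf (u.place.map f).1 a b hab hgeom
  -- `v` is rational too: a congruence to a constant modulo `u` descends along the local map
  obtain ⟨c, hc⟩ := hB (Curve.localRingMap f u.place a)
  refine ⟨c, ?_⟩
  rw [← map_sub] at hc
  exact (IsLocalRing.maximalIdeal_comap (Curve.localRingMap f u.place)).le hc
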